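/- **Automaton.** Let $\mathcal A=(Q,q_0,Q_E,Q_A,\to,F_\forall,F_1,F_{>0})$ be an alternating nonzero automaton on a finite alphabet $\Sigma$: $Q$ is a finite totally ordered set of states with initial state $q_0$, partitioned into the states $Q_E$ of Eve and $Q_A$ of Adam; the transitions are local transitions $q\to_a q'$ and split transitions $q\to_a(r_0,r_1)$; $F_\forall,F_1,F_{>0}\subseteq Q$; and for every state $q$ and letter $a$ at least one transition has source $q$ and letter $a$. The transition graph has an edge from $q$ to $r$ if $q\to_a r$, $q\to_a(r,q')$ or $q\to_a(q',r)$ for some $a$ and $q'$. Write $q\equiv r$ if there are nonempty paths from $q$ to $r$ and from $r$ to $q$ in this graph. Assume that $\mathcal A$ has *limited choice for Adam*: for every $q\in Q_A$, all transitions with source $q$ are local and, for every letter $a$, at most one $q'$ satisfies both $q\to_a q'$ and $q\equiv q'$. Assume also that $\mathcal A$ has *no local loop*: there are no letter $a$ and local transitions $q_0\to_a q_1\to_a\cdots\to_a q_i$ with $i\ge 1$ and $q_i=q_0$. **Game.** Fix an input tree $t:\{0,1\}^*\to\Sigma$. Vertices of the acceptance game are the pairs $(n,q)\in\{0,1\}^*\times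 Q$; plays are finite or infinite sequences of vertices. A strategy $\sigma$ of Eve (resp. $\tau$ of Adam) associates with every finite play whose last vertex $(n,q)$ has $q\in Q_E$ (resp. $q\in Q_A$) a transition with source $q$ and letter $t(n)$; it is *positional* if this transition depends only on the last vertex. From the initial vertex $(\epsilon,q_0)$, two strategies $\sigma,\tau$ induce a stochastic process: if $q\to_{t(n)}q'$ is chosen at $(n,q)$, the next vertex is $(n,q')$; if $q\to_{t(n)}(r_0,r_1)$ is chosen, it is $(n0,r_0)$ or $(n1,r_1)$, each with probability $\frac12$. Let $\mathbb P^{\sigma,\tau}$ be the resulting probability measure on infinite plays, for the $\sigma$-field generated by cylinders. A finite play is consistent with $\sigma$ and $\tau$ if it may occur in this process, and it is a $\sigma$-play if it is consistent with $\sigma$ and some $\tau$; an infinite play is consistent with $\sigma$ and $\tau$ (resp. is a $\sigma$-play) if all its finite prefixes are. The limsup of an infinite play is the largest state visited infinitely often. A strategy $\sigma$ of Eve is *surely winning* if, for every strategy $\tau$ of Adam, every infinite play consistent with $\sigma$ and $\tau$ has limsup in $F_\forall$. It is *almost-surely winning* if, for every $\tau$, $\mathbb P^{\sigma,\tau}$-almost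 every infinite play has limsup in $F_1$. For $q\in Q$, a branch $b\in\{0,1\}^\omega$ is a *$q$-branch* in $\sigma$ if some infinite $\sigma$-play with limsup $q$ visits every finite prefix of $b$. **Lemma.** Let $\sigma$ be a positional strategy of Eve. Then $\sigma$ is surely winning if and only if, for every $q\in Q\setminus F_\forall$, there is no $q$-branch in $\sigma$. Moreover, $\sigma$ is almost-surely winning if and only if, for every $q\in Q\setminus F_1$, the set of $q$-branches in $\sigma$ has measure $0$ for the uniform probability measure on $\{0,1\}^\omega$. -/

import Mathlib

open MeasureTheory ProbabilityTheory Filter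

namespace NonzeroAutomata

/-- A node of the infinite binary tree: a finite word, with `false` for direction `0`
and `true` for direction `1`.  The son of `n` in direction `d` is `n ++ [d]`. -/
abbrev Node : Type := List Bool

/-- An infinite branch of the binary tree. -/
abbrev Branch : Type := ℕ → Bool

/-- The prefix of length `k` of a branch. -/
def Branch.pre (b : Branch) (k : ℕ) : Node := (List.range k).map b

/-- The uniform probability measure on branches: independent fair coin flips. -/
noncomputable def branchMeasure : Measure Branch :=
  Measure.infinitePi fun _ : ℕ => (PMF.uniformOfFintype Bool).toMeasure

/-- An alternating nonzero automaton on the alphabet `A` with set of states `Q`.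
The states controlled by Adam are those outside `eve`.  Finiteness of `A` and `Q` and the total
order on `Q` are instance arguments where they are needed. -/
structure Automaton (A Q : Type*) where
  /-- initial state -/
  init : Q
  /-- states controlled by Eve -/
  eve : Set Q
  /-- local transitions `q →_a q'` -/
  localTr : Q → A → Q → Prop
  /-- split transitions `q →_a (r₀, r₁)` -/
  splitTr : Q → A → Q → Q → Prop
  /-- sure states `F_∀` -/
  Fall : Set Q
  /-- almost-sure states `F_1` -/
  Fone : Set Q
  /-- positive states `F_{>0}` -/
  Fpos : Set Q
  /-- from every state and on every letter there is at least one transition -/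
  complete : ∀ q a, (∃ q', localTr q a q') ∨ ∃ r₀ r₁, splitTr q a r₀ r₁

/-- What a transition does, once its source and its letter are known. -/
inductive Move (Q : Type*) where
  /-- local transition to the given state -/
  | stay : Q → Move Q
  /-- split transition to the given pair of states -/
  | split : Q → Q → Move Q

/-- A vertex of the acceptance game. -/
structure Vertex (Q : Type*) where
  node : Node
  state : Q

/-- A finite play with `k + 1` vertices. -/
abbrev FinPlay (Q : Type*) (k : ℕ) : Type _ := Finset.Iic k → Vertex Q

/-- An infinite play. -/
abbrev Play (Q : Type*) : Type _ := ℕ → Vertex Q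

/-- The set of vertices is discrete; the `σ`-field on plays is then the product one,
generated by cylinders. -/
instance (Q : Type*) : MeasurableSpace (Vertex Q) := ⊤

instance (Q : Type*) : DiscreteMeasurableSpace (Vertex Q) := ⟨fun _ => trivial⟩

instance (Q : Type*) [Finite Q] : Countable (Vertex Q) :=
  Function.Injective.countable (f := fun v : Vertex Q => (v.node, v.state)) (by
    rintro ⟨n, q⟩ ⟨n', q'⟩ h
    simpa using h)

/-- The last vertex of a finite play. -/
def FinPlay.last {Q : Type*} {k : ℕ} (π : FinPlay Q k) : Vertex Q :=
  π ⟨k, Finset.mem_Iic.2 le_rfl⟩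

/-- The finite prefix, with `k + 1` vertices, of an infinite play. -/
def Play.pre {Q : Type*} (π : Play Q) (k : ℕ) : FinPlay Q k := fun i => π i

/-- `q` is the limsup of the infinite play `π`: the largest state visited infinitely often. -/
def Play.IsLimsup {Q : Type*} [LinearOrder Q] (π : Play Q) (q : Q) : Prop :=
  IsGreatest {r : Q | ∃ᶠ i in atTop, (π i).state = r} q

/-- The infinite play `π` has its limsup in `F`. -/
def Play.LimsupIn {Q : Type*} [LinearOrder Q] (π : Play Q) (F : Set Q) : Prop :=
  ∃ q ∈ F, π.IsLimsup q

/-- The infinite play `π` projects to `b`: every prefix of `b` is visited by `π`. -/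
def Play.ProjectsTo {Q : Type*} (π : Play Q) (b : Branch) : Prop :=
  ∀ k, ∃ i, (π i).node = b.pre k

namespace Automaton

variable {A Q : Type*}

/-- The edges of the transition graph (labels forgotten). -/
def Edge (𝒜 : Automaton A Q) (q r : Q) : Prop :=
  ∃ a, 𝒜.localTr q a r ∨ ∃ q', 𝒜.splitTr q a r q' ∨ 𝒜.splitTr q a q' r

/-- Two states are equivalent if they lie in the same (strongly) connected component of the
transition graph, that is, on a common cycle.  A state on no cycle is in no component. -/
def Equivalent (𝒜 : Automaton A Q) (q r : Q) : Prop :=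
  Relation.TransGen 𝒜.Edge q r ∧ Relation.TransGen 𝒜.Edge r q

/-- Limited choice for Adam. -/
def LimitedChoice (𝒜 : Automaton A Q) : Prop :=
  ∀ q ∉ 𝒜.eve,
    (∀ a r₀ r₁, ¬ 𝒜.splitTr q a r₀ r₁) ∧
    ∀ a q₁ q₂, 𝒜.localTr q a q₁ → 𝒜.localTr q a q₂ →
      𝒜.Equivalent q q₁ → 𝒜.Equivalent q q₂ → q₁ = q₂

/-- No local loop: there is no cycle of local transitions on a single letter. -/
def NoLocalLoop (𝒜 : Automaton A Q) : Prop :=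
  ∀ a q, ¬ Relation.TransGen (fun p r => 𝒜.localTr p a r) q q

/-- The transitions with source `q` and letter `a`. -/
def Legal (𝒜 : Automaton A Q) (q : Q) (a : A) : Move Q → Prop
  | .stay q' => 𝒜.localTr q a q'
  | .split r₀ r₁ => 𝒜.splitTr q a r₀ r₁

/-- Strategies, in the acceptance game of `𝒜` on the tree `t`, for the player controlling the
states in `P`: to every finite play whose last vertex is controlled by the player is associated a
transition available there. -/
def Strategy (𝒜 : Automaton A Q) (t : Node → A) (P : Set Q) : Type _ :=
  ∀ (k : ℕ) (π : FinPlay Q k), π.last.state ∈ P →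
    {m : Move Q // 𝒜.Legal π.last.state (t π.last.node) m}

/-- Strategies of Eve. -/
abbrev EveStrategy (𝒜 : Automaton A Q) (t : Node → A) : Type _ := 𝒜.Strategy t 𝒜.eve

/-- Strategies of Adam. -/
abbrev AdamStrategy (𝒜 : Automaton A Q) (t : Node → A) : Type _ := 𝒜.Strategy t 𝒜.eveᶜ

variable {𝒜 : Automaton A Q} {t : Node → A}

/-- A strategy is positional if its choice depends only on the last vertex of the play. -/
def Strategy.Positional {P : Set Q} (σ : 𝒜.Strategy t P) : Prop :=
  ∀ (k k' : ℕ) (π : FinPlay Q k) (π' : FinPlay Q k')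
    (h : π.last.state ∈ P) (h' : π'.last.state ∈ P),
    π.last = π'.last → (σ k π h).1 = (σ k' π' h').1

open Classical in
/-- The transition chosen after the finite play `π` by the player who controls its last vertex. -/
noncomputable def choice (σ : 𝒜.EveStrategy t) (τ : 𝒜.AdamStrategy t) (k : ℕ)
    (π : FinPlay Q k) : Move Q :=
  if h : π.last.state ∈ 𝒜.eve then (σ k π h).1 else (τ k π h).1

end Automaton

/-- The law of the next vertex when a move is played from a vertex: a local transition stays on the
current node, a split transition goes to each of the two sons with probability `1/2`. -/
noncomputable def Move.next {Q : Type*} (v : Vertex Q) : Move Q → PMF (Vertex Q)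
  | .stay q' => PMF.pure ⟨v.node, q'⟩
  | .split r₀ r₁ => (PMF.uniformOfFintype Bool).map fun d => ⟨v.node ++ [d], bif d then r₁ else r₀⟩

namespace Automaton

variable {A Q : Type*} {𝒜 : Automaton A Q} {t : Node → A}

/-- The initial vertex. -/
def start (𝒜 : Automaton A Q) : Vertex Q := ⟨[], 𝒜.init⟩

/-- The law of the vertex following the finite play `π`, when Eve plays `σ` and Adam plays `τ`. -/
noncomputable def step (σ : 𝒜.EveStrategy t) (τ : 𝒜.AdamStrategy t) (k : ℕ) (π : FinPlay Q k) :
    PMF (Vertex Q) :=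
  (choice σ τ k π).next π.last

/-- `step` as a Markov kernel (all the spaces are countable and discrete). -/
noncomputable def stepKernel [Finite Q] (σ : 𝒜.EveStrategy t) (τ : 𝒜.AdamStrategy t) (k : ℕ) :
    Kernel (FinPlay Q k) (Vertex Q) where
  toFun π := (step σ τ k π).toMeasure
  measurable' := measurable_of_countable _

instance [Finite Q] (σ : 𝒜.EveStrategy t) (τ : 𝒜.AdamStrategy t) (k : ℕ) :
    IsMarkovKernel (stepKernel σ τ k) :=
  ⟨fun π => by change IsProbabilityMeasure (step σ τ k π).toMeasure; infer_instance⟩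

/-- The probability measure on infinite plays induced by the strategies `σ` and `τ`, given by the
Ionescu-Tulcea theorem, for plays that start in the initial vertex. -/
noncomputable def playMeasure [Finite Q] (σ : 𝒜.EveStrategy t) (τ : 𝒜.AdamStrategy t) :
    Measure (Play Q) :=
  Kernel.traj (X := fun _ => Vertex Q) (stepKernel σ τ) 0 (fun _ => 𝒜.start)

/-- The finite play `π` is consistent with `σ` and `τ`: it may occur in the Markov chain, i.e.
it starts in the initial vertex and all its steps have positive probability. -/
def FinConsistent (σ : 𝒜.EveStrategy t) (τ : 𝒜.AdamStrategy t) {k : ℕ} (π : FinPlay Q k) : Prop :=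
  π ⟨0, Finset.mem_Iic.2 (Nat.zero_le k)⟩ = 𝒜.start ∧
  ∀ (i : ℕ) (h : i + 1 ≤ k),
    0 < step σ τ i (fun j => π ⟨j, Finset.mem_Iic.2
        ((Finset.mem_Iic.1 j.2).trans ((Nat.le_succ i).trans h))⟩)
      (π ⟨i + 1, Finset.mem_Iic.2 h⟩)

/-- The infinite play `π` is consistent with `σ` and `τ`: all its prefixes are. -/
def Consistent (σ : 𝒜.EveStrategy t) (τ : 𝒜.AdamStrategy t) (π : Play Q) : Prop :=
  ∀ k, FinConsistent σ τ (π.pre k)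

/-- The infinite play `π` is a `σ`-play: for every finite prefix there is a strategy of Adam with
which that prefix may occur. -/
def IsPlayOf (σ : 𝒜.EveStrategy t) (π : Play Q) : Prop :=
  ∀ k, ∃ τ : 𝒜.AdamStrategy t, FinConsistent σ τ (π.pre k)

/-- `b` is a `q`-branch in `σ`: some infinite `σ`-play with limsup `q` projects to `b`. -/
def IsQBranch [LinearOrder Q] (σ : 𝒜.EveStrategy t) (q : Q) (b : Branch) : Prop :=
  ∃ π : Play Q, IsPlayOf σ π ∧ π.ProjectsTo b ∧ π.IsLimsup q

/-- `σ` is surely winning: against every strategy of Adam, every consistent infinite play has its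
limsup in `F_∀`. -/
def SurelyWinning [LinearOrder Q] (σ : 𝒜.EveStrategy t) : Prop :=
  ∀ τ : 𝒜.AdamStrategy t, ∀ π : Play Q, Consistent σ τ π → π.LimsupIn 𝒜.Fall

/-- `σ` is almost-surely winning: against every strategy of Adam, almost every play has its
limsup in `F_1`. -/
def AlmostSurelyWinning [Finite Q] [LinearOrder Q] (σ : 𝒜.EveStrategy t) : Prop :=
  ∀ τ : 𝒜.AdamStrategy t, ∀ᵐ π ∂(playMeasure σ τ), π.LimsupIn 𝒜.Fone

end Automaton

end NonzeroAutomata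

/-! Fix strategies `σ`, `τ`. Without local loops a consistent play leaves every node it visits, so
it projects to a branch; conversely each branch `b` carries exactly one consistent play, `path σ τ
b`, because the only randomness is the direction taken at splits. For sure winning, this matches
losing plays with `q`-branches, `q ∉ F_∀`.

For almost-sure winning, index the coins by depth rather than by time: `playMeasure_eq_map` then
identifies the play measure with the image of the uniform measure under `path σ τ`. If `q`-branches
are null for the finitely many bad `q`, almost every `path σ τ b` has a good limsup. In the other
direction the play witnessing a `q`-branch may need any of uncountably many strategies of Adam. But
every play ends up in one strongly connected component, where limited choice leaves Adam a single
way to remain. So the play is consistent with some `followThenRemain σ ρ`, `ρ` a finite play; there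
are countably many `ρ`, hence countably many null sets to discard. -/

namespace NonzeroAutomata

/-! ### Moves as functions of a coin; limsup of a play. -/

section Moves

variable {Q : Type*}

/-- The vertex reached from `v` by a move when the coin shows `d`. -/
def Move.succ (v : Vertex Q) (d : Bool) : Move Q → Vertex Q
  | .stay q' => ⟨v.node, q'⟩
  | .split r₀ r₁ => ⟨v.node ++ [d], bif d then r₁ else r₀⟩

/-- Tossing a coin even at local moves, which ignore it, makes every step a function of one fair
bit. -/
theorem Move.next_eq_map_succ (v : Vertex Q) (m : Move Q) :
    m.next v = (PMF.uniformOfFintype Bool).map fun d => m.succ v d := by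
  cases m with
  | stay q' => exact (PMF.map_const _ _).symm
  | split r₀ r₁ => rfl

theorem Move.next_pos_iff (v w : Vertex Q) (m : Move Q) :
    0 < m.next v w ↔ ∃ d, w = m.succ v d := by
  rw [pos_iff_ne_zero, ← PMF.mem_support_iff, Move.next_eq_map_succ, PMF.mem_support_map_iff]
  simp [eq_comm]

theorem Move.node_prefix_succ (v : Vertex Q) (m : Move Q) (d : Bool) :
    v.node <+: (m.succ v d).node := by
  cases m <;> simp [Move.succ]

theorem Move.length_succ_le (v : Vertex Q) (m : Move Q) (d : Bool) :
    (m.succ v d).node.length ≤ v.node.length + 1 := by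
  cases m <;> simp [Move.succ]

theorem Play.IsLimsup.unique [LinearOrder Q] {π : Play Q} {q r : Q} (hq : π.IsLimsup q)
    (hr : π.IsLimsup r) : q = r :=
  IsGreatest.unique hq hr

theorem Play.exists_isLimsup [Finite Q] [LinearOrder Q] (π : Play Q) : ∃ q, π.IsLimsup q := by
  have hne : {r : Q | ∃ᶠ i in atTop, (π i).state = r}.Nonempty := by
    by_contra h
    rw [Set.not_nonempty_iff_eq_empty, Set.eq_empty_iff_forall_notMem] at h
    have h' : ∀ r : Q, ∀ᶠ i in atTop, (π i).state ≠ r := fun r => not_frequently.1 (h r)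
    obtain ⟨i, hi⟩ := (eventually_all.2 h').exists
    exact hi _ rfl
  obtain ⟨q, hq⟩ := (Set.toFinite {r : Q | ∃ᶠ i in atTop, (π i).state = r}).exists_maximal hne
  exact ⟨q, hq.1, fun r hr => (le_total r q).elim id fun h => hq.2 hr h⟩

theorem Play.measurableSet_limsupIn [Finite Q] [LinearOrder Q] (F : Set Q) :
    MeasurableSet {π : Play Q | π.LimsupIn F} := by
  have hfreq : ∀ r : Q, MeasurableSet {π : Play Q | ∃ᶠ i in atTop, (π i).state = r} := by
    intro r
    simp only [frequently_atTop, Set.ofPred_forall, Set.ofPred_exists]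
    refine .iInter fun a => .iUnion fun i => ?_
    refine MeasurableSet.inter (.const _) ?_
    exact measurable_pi_apply (X := fun _ : ℕ => Vertex Q) i
      (MeasurableSet.of_discrete (s := {v : Vertex Q | v.state = r}))
  have : {π : Play Q | π.LimsupIn F} = ⋃ q ∈ F, ({π | ∃ᶠ i in atTop, (π i).state = q} ∩
      ⋂ r ∈ {r | ¬ r ≤ q}, {π | ∃ᶠ i in atTop, (π i).state = r}ᶜ) := by
    ext π
    simp only [Play.LimsupIn, Play.IsLimsup, IsGreatest, upperBounds, Set.mem_ofPred_eq,
      Set.mem_iUnion, Set.mem_inter_iff, Set.mem_iInter, Set.mem_compl_iff, exists_prop]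
    refine exists_congr fun q => and_congr_right fun _ => and_congr_right fun _ =>
      forall_congr' fun r => ?_
    tauto
  rw [this]
  exact .biUnion F.to_countable fun q _ => (hfreq q).inter <|
    .biInter (Set.to_countable _) fun r _ => (hfreq r).compl

end Moves

/-! ### Branches and fair coins. -/

section Branches

theorem Branch.length_pre (b : Branch) (k : ℕ) : (b.pre k).length = k := by simp [Branch.pre]

theorem Branch.pre_succ (b : Branch) (k : ℕ) : b.pre (k + 1) = b.pre k ++ [b k] := by
  simp [Branch.pre, List.range_succ]

theorem Branch.pre_eq_pre_iff (b c : Branch) (k : ℕ) : b.pre k = c.pre k ↔ ∀ i < k, b i = c i := by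
  simp [Branch.pre, List.map_inj_left]

/-- A set of branches prescribing the first `l` bits and restricting the next one to `D`. -/
theorem branchMeasure_agree_inter (c : Branch) (l : ℕ) (D : Set Bool) :
    branchMeasure {b | (∀ i < l, b i = c i) ∧ b l ∈ D} =
      branchMeasure {b | ∀ i < l, b i = c i} * (PMF.uniformOfFintype Bool).toMeasure D := by
  have h1 : {b : Branch | (∀ i < l, b i = c i) ∧ b l ∈ D} =
      Set.pi (Finset.range (l + 1)) (fun i => if i = l then D else {c i}) := by
    ext b
    simp only [Set.mem_ofPred_eq, Set.mem_pi, Finset.coe_range, Set.mem_Iio]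
    constructor
    · rintro ⟨h, h'⟩ i hi
      split_ifs with hl
      · exact hl ▸ h'
      · exact h i (by omega)
    · intro h
      refine ⟨fun i hi => ?_, by simpa using h l (by omega)⟩
      simpa [hi.ne] using h i (by omega)
  have h2 : {b : Branch | ∀ i < l, b i = c i} =
      Set.pi (Finset.range l) (fun i => {c i}) := by
    ext b
    simp [Set.mem_pi]
  rw [h1, h2, branchMeasure, Measure.infinitePi_pi _ fun _ _ => .of_discrete,
    Measure.infinitePi_pi _ fun _ _ => .of_discrete, Finset.prod_range_succ, if_pos rfl]
  congr 1
  exact Finset.prod_congr rfl fun i hi => by rw [if_neg (Finset.mem_range.1 hi).ne]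

instance : IsProbabilityMeasure branchMeasure := by
  unfold branchMeasure; infer_instance

end Branches

/-! ### Markov chains on countable spaces. -/

section Chains

/-- The trajectory of a Markov chain on a countable space: probability of a finite path. -/
theorem partialTraj_succ_singleton {X : ℕ → Type*} [∀ n, MeasurableSpace (X n)]
    [∀ n, MeasurableSingletonClass (X n)] [∀ n, Countable (X n)]
    (κ : (n : ℕ) → Kernel ((i : Finset.Iic n) → X i) (X (n + 1))) [∀ n, IsMarkovKernel (κ n)]
    (x : (i : Finset.Iic 0) → X i) (k : ℕ)
    (ρ : (i : Finset.Iic (k + 1)) → X i) :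
    Kernel.partialTraj κ 0 (k + 1) x {ρ} =
      Kernel.partialTraj κ 0 k x {Preorder.frestrictLe₂ (π := X) k.le_succ ρ} *
        κ k (Preorder.frestrictLe₂ (π := X) k.le_succ ρ)
          {ρ ⟨k + 1, Finset.mem_Iic.2 le_rfl⟩} := by
  set ρ' := Preorder.frestrictLe₂ (π := X) k.le_succ ρ with hρ'
  rw [Kernel.partialTraj_succ_eq_comp (Nat.zero_le k),
    Kernel.comp_apply' _ _ _ (measurableSet_singleton ρ)]
  -- Only the truncation `ρ'` can be extended to `ρ`, so the composition integral has a single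
  -- nonzero term.
  have key : ∀ y : (i : Finset.Iic k) → X i,
      Kernel.partialTraj κ k (k + 1) y {ρ} =
      Set.indicator {ρ'} (fun _ => κ k ρ' {ρ ⟨k + 1, Finset.mem_Iic.2 le_rfl⟩}) y := by
    intro y
    rw [Kernel.partialTraj_succ_self, Kernel.map_apply' _ measurable_IicProdIoc _
      (measurableSet_singleton ρ), Kernel.id_prod_apply' _ _
      (measurable_IicProdIoc (measurableSet_singleton ρ)), Kernel.map_apply' _
      (MeasurableEquiv.measurable _) _ (.of_discrete)]
    by_cases hy : y = ρ'
    · subst hy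
      rw [Set.indicator_of_mem (Set.mem_singleton _)]
      congr 1
      ext w
      simp only [Set.mem_preimage, Set.mem_singleton_iff]
      constructor
      · intro h
        have := congrFun h ⟨k + 1, Finset.mem_Iic.2 le_rfl⟩
        simpa [IicProdIoc, MeasurableEquiv.piSingleton] using this
      · rintro rfl
        funext ⟨i, hi⟩
        by_cases hik : i ≤ k
        · simp [IicProdIoc, hik, hρ']
        · obtain rfl : i = k + 1 := by have := Finset.mem_Iic.1 hi; omega
          simp [IicProdIoc, MeasurableEquiv.piSingleton]
    · rw [Set.indicator_of_notMem (by simpa using hy)]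
      refine (congrArg _ (Set.eq_empty_iff_forall_notMem.2 ?_)).trans measure_empty
      intro w h
      apply hy
      simp only [Set.mem_preimage, Set.mem_singleton_iff] at h
      funext ⟨i, hi⟩
      have := congrFun h ⟨i, Finset.mem_Iic.2 ((Finset.mem_Iic.1 hi).trans k.le_succ)⟩
      simpa [IicProdIoc, Finset.mem_Iic.1 hi, hρ'] using this
  simp_rw [key]
  rw [lintegral_indicator_const (measurableSet_singleton _), mul_comm]

/-- A measure with the finite-dimensional laws of a Markov chain is the law of its trajectory. -/
theorem traj_eq_of_map_frestrictLe {X : ℕ → Type*} [∀ n, MeasurableSpace (X n)]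
    (κ : (n : ℕ) → Kernel ((i : Finset.Iic n) → X i) (X (n + 1))) [∀ n, IsMarkovKernel (κ n)]
    (x : (i : Finset.Iic 0) → X i) (ν : Measure ((n : ℕ) → X n))
    (h : ∀ n, ν.map (Preorder.frestrictLe n) = Kernel.partialTraj κ 0 n x) :
    Kernel.traj κ 0 x = ν := by
  refine (Kernel.isProjectiveLimit_trajFun κ 0 x).unique ?_
  rw [isProjectiveLimit_nat_iff (Kernel.isProjectiveMeasureFamily_partialTraj κ x)]
  intro n
  rw [inducedFamily_Iic, h]

end Chains

/-! ### Consistent plays. -/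

namespace Automaton

variable {A Q : Type*} {𝒜 : Automaton A Q} {t : Node → A}

theorem legal_choice (σ : 𝒜.EveStrategy t) (τ : 𝒜.AdamStrategy t) (k : ℕ) (ρ : FinPlay Q k) :
    𝒜.Legal ρ.last.state (t ρ.last.node) (choice σ τ k ρ) := by
  unfold choice
  split_ifs with h
  · exact (σ k ρ h).2
  · exact (τ k ρ h).2

theorem finConsistent_pre_iff {σ : 𝒜.EveStrategy t} {τ : 𝒜.AdamStrategy t} {π : Play Q} {k : ℕ} :
    FinConsistent σ τ (π.pre k) ↔ π 0 = 𝒜.start ∧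
      ∀ i < k, ∃ d, π (i + 1) = (choice σ τ i (π.pre i)).succ (π i) d :=
  and_congr Iff.rfl (forall₂_congr fun _ _ => Move.next_pos_iff _ _ _)

theorem consistent_iff {σ : 𝒜.EveStrategy t} {τ : 𝒜.AdamStrategy t} {π : Play Q} :
    Consistent σ τ π ↔ π 0 = 𝒜.start ∧
      ∀ i, ∃ d, π (i + 1) = (choice σ τ i (π.pre i)).succ (π i) d := by
  simp only [Consistent, finConsistent_pre_iff]
  exact ⟨fun h => ⟨(h 0).1, fun i => (h (i + 1)).2 i i.lt_succ_self⟩,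
    fun h k => ⟨h.1, fun i _ => h.2 i⟩⟩

theorem Consistent.isPlayOf {σ : 𝒜.EveStrategy t} {τ : 𝒜.AdamStrategy t} {π : Play Q}
    (h : Consistent σ τ π) : IsPlayOf σ π :=
  fun k => ⟨τ, h k⟩

theorem choice_congr_adam {σ : 𝒜.EveStrategy t} {τ τ' : 𝒜.AdamStrategy t} {k : ℕ} {ρ : FinPlay Q k}
    (h : ∀ hρ, τ k ρ hρ = τ' k ρ hρ) : choice σ τ k ρ = choice σ τ' k ρ := by
  unfold choice
  split_ifs with hρ
  · rfl
  · rw [h]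

/-- The strategies witnessing the prefixes can be glued: step `k` only involves the choice at time
`k`, so it suffices to use there the witness for the prefix ending at time `k + 1`. -/
theorem IsPlayOf.exists_consistent {σ : 𝒜.EveStrategy t} {π : Play Q} (h : IsPlayOf σ π) :
    ∃ τ, Consistent σ τ π := by
  choose τ hτ using h
  refine ⟨fun k ρ hρ => τ (k + 1) k ρ hρ, consistent_iff.2 ⟨(hτ 0).1, fun i => ?_⟩⟩
  obtain ⟨d, hd⟩ := (finConsistent_pre_iff.1 (hτ (i + 1))).2 i i.lt_succ_self
  exact ⟨d, by rw [hd]; congr 1⟩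

section Consistent

variable {σ : 𝒜.EveStrategy t} {τ : 𝒜.AdamStrategy t} {π : Play Q}

theorem Consistent.node_prefix (h : Consistent σ τ π) {i j : ℕ} (hij : i ≤ j) :
    (π i).node <+: (π j).node := by
  induction j, hij using Nat.le_induction with
  | base => exact List.prefix_rfl
  | succ j _ ih =>
    obtain ⟨d, hd⟩ := (consistent_iff.1 h).2 j
    exact ih.trans (hd ▸ Move.node_prefix_succ _ _ _)

theorem Consistent.node_eq_of_length_eq (h : Consistent σ τ π) {i j : ℕ}
    (hij : (π i).node.length = (π j).node.length) : (π i).node = (π j).node := by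
  rcases le_total i j with hl | hl
  · exact (h.node_prefix hl).eq_of_length hij
  · exact ((h.node_prefix hl).eq_of_length hij.symm).symm

theorem Consistent.localTr_of_node_eq (h : Consistent σ τ π) {i : ℕ}
    (hi : (π (i + 1)).node = (π i).node) :
    𝒜.localTr (π i).state (t (π i).node) (π (i + 1)).state := by
  obtain ⟨d, hd⟩ := (consistent_iff.1 h).2 i
  have hl : 𝒜.Legal (π i).state (t (π i).node) _ := legal_choice σ τ i (π.pre i)
  cases hm : choice σ τ i (π.pre i) with
  | stay q' => rw [hm] at hd hl; rw [hd]; exact hl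
  | split r₀ r₁ => rw [hd, hm] at hi; simp [Move.succ] at hi

theorem Consistent.edge (h : Consistent σ τ π) (i : ℕ) :
    𝒜.Edge (π i).state (π (i + 1)).state := by
  obtain ⟨d, hd⟩ := (consistent_iff.1 h).2 i
  have hl : 𝒜.Legal (π i).state (t (π i).node) _ := legal_choice σ τ i (π.pre i)
  refine ⟨t (π i).node, ?_⟩
  cases hm : choice σ τ i (π.pre i) with
  | stay q' => rw [hm] at hd hl; rw [hd]; exact .inl hl
  | split r₀ r₁ =>
    rw [hm] at hd hl
    rw [hd]
    cases d
    · exact .inr ⟨r₁, .inl hl⟩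
    · exact .inr ⟨r₀, .inr hl⟩

theorem transGen_of_lt {α : Type*} {r : α → α → Prop} {f : ℕ → α} {i j : ℕ} (hij : i < j)
    (h : ∀ k, i ≤ k → k < j → r (f k) (f (k + 1))) : Relation.TransGen r (f i) (f j) := by
  induction j, hij using Nat.le_induction with
  | base => exact .single (h i le_rfl i.lt_succ_self)
  | succ j hj ih =>
    exact .tail (ih fun k hk hkj => h k hk (hkj.trans j.lt_succ_self))
      (h j (by omega) j.lt_succ_self)

/-- Without local loops, a play does not stay on a node forever. -/
theorem Consistent.exists_node_ne [Finite Q] (hloop : 𝒜.NoLocalLoop) (h : Consistent σ τ π)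
    (i : ℕ) : ∃ j ≥ i, (π j).node ≠ (π i).node := by
  by_contra! hc
  -- Pigeonhole: some state repeats while the node, hence the letter, is fixed, which closes a local
  -- loop.
  obtain ⟨j, j', hjj', hs⟩ : ∃ j j', j < j' ∧ (π (i + j)).state = (π (i + j')).state := by
    obtain ⟨j, j', hne, hs⟩ := Finite.exists_ne_map_eq_of_infinite fun j => (π (i + j)).state
    rcases hne.lt_or_gt with hl | hl
    · exact ⟨j, j', hl, hs⟩
    · exact ⟨j', j, hl, hs.symm⟩
  refine hloop (t (π i).node) (π (i + j)).state ?_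
  have := transGen_of_lt (r := fun p r => 𝒜.localTr p (t (π i).node) r) (f := fun k => (π k).state)
    (i := i + j) (j := i + j') (by omega) fun k hk _ => by
      have hk' := h.localTr_of_node_eq (i := k)
        ((hc (k + 1) (by omega)).trans (hc k (by omega)).symm)
      rwa [hc k (by omega)] at hk'
  simpa only [← hs] using this

/-- Depth is unbounded and grows by at most one per step, so the first time it reaches `k` it equals
`k`. -/
theorem Consistent.exists_length_eq [Finite Q] (hloop : 𝒜.NoLocalLoop) (h : Consistent σ τ π)
    (k : ℕ) : ∃ i, (π i).node.length = k := by
  have hlarge : ∃ i, k ≤ (π i).node.length := by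
    induction k with
    | zero => exact ⟨0, Nat.zero_le _⟩
    | succ k ih =>
      obtain ⟨i, hi⟩ := ih
      obtain ⟨j, hij, hj⟩ := h.exists_node_ne hloop i
      refine ⟨j, ?_⟩
      have hp := h.node_prefix hij
      have := hp.length_le.lt_of_ne fun he => hj (hp.eq_of_length he).symm
      omega
  classical
  refine ⟨Nat.find hlarge, le_antisymm ?_ (Nat.find_spec hlarge)⟩
  cases hn : Nat.find hlarge with
  | zero => rw [(consistent_iff.1 h).1]; exact Nat.zero_le _
  | succ n =>
    have hlt := Nat.find_min hlarge (m := n) (by omega)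
    obtain ⟨d, hd⟩ := (consistent_iff.1 h).2 n
    have := Move.length_succ_le (π n) (choice σ τ n (π.pre n)) d
    rw [hd]
    omega

theorem Consistent.exists_projectsTo [Finite Q] (hloop : 𝒜.NoLocalLoop) (h : Consistent σ τ π) :
    ∃ b, π.ProjectsTo b := by
  choose f hf using h.exists_length_eq hloop
  -- Bit `k` is the last letter of the node at depth `k + 1`; that node is nonempty, so the default
  -- is never used.
  refine ⟨fun k => (π (f (k + 1))).node.getLast?.getD false, fun k => ⟨f k, ?_⟩⟩
  induction k with
  | zero => exact List.eq_nil_of_length_eq_zero (hf 0)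
  | succ k ih =>
    rw [Branch.pre_succ, ← ih]
    have hp : (π (f k)).node <+: (π (f (k + 1))).node := by
      rcases le_total (f k) (f (k + 1)) with hl | hl
      · exact h.node_prefix hl
      · have := (h.node_prefix hl).length_le
        rw [hf, hf] at this
        omega
    obtain ⟨s, hs⟩ := hp
    have hlen : s.length = 1 := by
      have := congrArg List.length hs
      rw [List.length_append, hf, hf] at this
      omega
    obtain ⟨a, rfl⟩ := List.length_eq_one_iff.1 hlen
    simp [← hs]

theorem Consistent.node_eq_pre (h : Consistent σ τ π) {b : Branch} (hb : π.ProjectsTo b) (i : ℕ) :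
    (π i).node = b.pre (π i).node.length := by
  obtain ⟨j, hj⟩ := hb (π i).node.length
  rw [← hj]
  exact h.node_eq_of_length_eq (by rw [hj, Branch.length_pre])

/-- Eventually only states visited infinitely often occur; returning to such a state puts it on a
cycle with its successor. -/
theorem Consistent.eventually_equivalent [Finite Q] (h : Consistent σ τ π) :
    ∃ k, ∀ i ≥ k, 𝒜.Equivalent (π i).state (π (i + 1)).state := by
  have hev : ∀ᶠ i in atTop, ∀ r, (π i).state = r → ∃ᶠ j in atTop, (π j).state = r := by
    refine eventually_all.2 fun r => ?_
    by_cases hr : ∃ᶠ j in atTop, (π j).state = r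
    · exact .of_forall fun _ _ => hr
    · exact (not_frequently.1 hr).mono fun i hi hi' => absurd hi' hi
  obtain ⟨k, hk⟩ := eventually_atTop.1 hev
  refine ⟨k, fun i hi => ⟨.single (h.edge i), ?_⟩⟩
  -- `i + 2` rather than `i + 1` makes the path back from the successor nonempty.
  obtain ⟨j, hj, hs⟩ := frequently_atTop.1 (hk i hi _ rfl) (i + 2)
  rw [← hs]
  exact transGen_of_lt (f := fun j => (π j).state) (by omega) fun l _ _ => h.edge l

end Consistent

/-! ### The play along a branch, and its law. -/

section Path

/-- The play driven by the coins of the branch `b`, computed up to time `k`. -/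
noncomputable def pathAux (σ : 𝒜.EveStrategy t) (τ : 𝒜.AdamStrategy t) (b : Branch) : ℕ → Play Q
  | 0 => fun _ => 𝒜.start
  | k + 1 => Function.update (pathAux σ τ b k) (k + 1)
      ((choice σ τ k ((pathAux σ τ b k).pre k)).succ (pathAux σ τ b k k)
        (b (pathAux σ τ b k k).node.length))

/-- The play induced by the strategies `σ` and `τ` which projects to the branch `b`. -/
noncomputable def path (σ : 𝒜.EveStrategy t) (τ : 𝒜.AdamStrategy t) (b : Branch) : Play Q :=
  fun k => pathAux σ τ b k k

variable (σ : 𝒜.EveStrategy t) (τ : 𝒜.AdamStrategy t) (b : Branch)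

theorem pathAux_of_le {i k : ℕ} (hik : i ≤ k) : pathAux σ τ b k i = path σ τ b i := by
  induction k, hik using Nat.le_induction with
  | base => rfl
  | succ k hk ih => rw [pathAux, Function.update_of_ne (by omega), ih]

theorem path_zero : path σ τ b 0 = 𝒜.start := rfl

/-- The bit is read at the depth of the current node, not at time `k`: local moves consume no coin,
so the play follows `b`. -/
theorem path_succ (k : ℕ) : path σ τ b (k + 1) =
    (choice σ τ k ((path σ τ b).pre k)).succ (path σ τ b k)
      (b (path σ τ b k).node.length) := by
  have hpre : (pathAux σ τ b k).pre k = (path σ τ b).pre k := by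
    funext i
    exact pathAux_of_le σ τ b (Finset.mem_Iic.1 i.2)
  change pathAux σ τ b (k + 1) (k + 1) = _
  rw [pathAux, Function.update_self, hpre]
  rfl

theorem consistent_path : Consistent σ τ (path σ τ b) :=
  consistent_iff.2 ⟨path_zero σ τ b, fun i => ⟨_, path_succ σ τ b i⟩⟩

theorem node_path_eq_pre (k : ℕ) :
    (path σ τ b k).node = b.pre (path σ τ b k).node.length := by
  induction k with
  | zero => rfl
  | succ k ih =>
    rw [path_succ]
    cases choice σ τ k ((path σ τ b).pre k) with
    | stay q' => exact ih
    | split r₀ r₁ => simp only [Move.succ, List.length_append, List.length_singleton,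
        Branch.pre_succ, ← ih]

theorem projectsTo_path [Finite Q] (hloop : 𝒜.NoLocalLoop) : (path σ τ b).ProjectsTo b := by
  intro k
  obtain ⟨i, hi⟩ := (consistent_path σ τ b).exists_length_eq hloop k
  exact ⟨i, by rw [node_path_eq_pre, hi]⟩

variable {σ τ b}

theorem pre_ext_succ {π π' : Play Q} {k : ℕ} (h : π.pre k = π'.pre k)
    (h' : π (k + 1) = π' (k + 1)) :
    π.pre (k + 1) = π'.pre (k + 1) := by
  funext ⟨i, hi⟩
  rcases (Finset.mem_Iic.1 hi).lt_or_eq with hl | rfl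
  · exact congrFun h ⟨i, Finset.mem_Iic.2 (by omega)⟩
  · exact h'

theorem apply_eq_of_pre_eq {π π' : Play Q} {k : ℕ} (h : π.pre k = π'.pre k) : π k = π' k :=
  congrFun h ⟨k, Finset.mem_Iic.2 le_rfl⟩

/-- At a split, the next node must be a prefix of `b`, which forces the direction. -/
theorem Consistent.eq_path {π : Play Q} (h : Consistent σ τ π) (hb : π.ProjectsTo b) :
    π = path σ τ b := by
  suffices H : ∀ k, π.pre k = (path σ τ b).pre k from funext fun k => apply_eq_of_pre_eq (H k)
  intro k
  induction k with
  | zero =>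
    funext ⟨i, hi⟩
    obtain rfl : i = 0 := by simpa using hi
    exact (consistent_iff.1 h).1
  | succ k ih =>
    refine pre_ext_succ ih ?_
    have hk := apply_eq_of_pre_eq ih
    obtain ⟨d, hd⟩ := (consistent_iff.1 h).2 k
    have hnode := h.node_eq_pre hb (k + 1)
    have hnode' := h.node_eq_pre hb k
    rw [path_succ, ← ih, ← hk, hd]
    rw [hd] at hnode
    cases hm : choice σ τ k (π.pre k) with
    | stay q' => rfl
    | split r₀ r₁ =>
      rw [hm] at hnode
      simp only [Move.succ, List.length_append, List.length_singleton, Branch.pre_succ,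
        ← hnode', List.append_cancel_left_eq, List.cons.injEq, and_true] at hnode
      rw [hnode]

/-- The current node records exactly the coins consumed so far. Fibres of the prefix map are
therefore cylinders. -/
theorem pre_path_eq_iff (c b : Branch) (k : ℕ) : (path σ τ b).pre k = (path σ τ c).pre k ↔
    ∀ i < (path σ τ c k).node.length, b i = c i := by
  constructor
  · intro h
    rw [← Branch.pre_eq_pre_iff, ← node_path_eq_pre]
    conv_lhs => rw [← apply_eq_of_pre_eq h]
    rw [← node_path_eq_pre, apply_eq_of_pre_eq h]
  · induction k with
    | zero =>
      intro _
      funext ⟨i, hi⟩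
      obtain rfl : i = 0 := by simpa using hi
      rfl
    | succ k ih =>
      intro h
      have hle := ((consistent_path σ τ c).node_prefix k.le_succ).length_le
      have hk := ih fun i hi => h i (hi.trans_le hle)
      refine pre_ext_succ hk ?_
      rw [path_succ, path_succ, hk, apply_eq_of_pre_eq hk]
      rw [path_succ] at h
      cases hm : choice σ τ k ((path σ τ c).pre k) with
      | stay q' => rfl
      | split r₀ r₁ =>
        rw [hm] at h
        rw [h (path σ τ c k).node.length (by simp [Move.succ])]

variable (σ τ)

theorem measurable_pre_path [Finite Q] (k : ℕ) : Measurable fun b => (path σ τ b).pre k := by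
  refine measurable_to_countable' fun ρ => ?_
  by_cases hρ : ∃ c, (path σ τ c).pre k = ρ
  · obtain ⟨c, rfl⟩ := hρ
    have : (fun b => (path σ τ b).pre k) ⁻¹' {(path σ τ c).pre k} =
        ⋂ i ∈ {i | i < (path σ τ c k).node.length}, (fun b : Branch => b i) ⁻¹' {c i} := by
      ext b
      simpa using pre_path_eq_iff c b k
    rw [this]
    exact .biInter (Set.to_countable _) fun i _ => measurable_pi_apply i (.of_discrete)
  · convert MeasurableSet.empty
    exact Set.eq_empty_iff_forall_notMem.2 fun b hb => hρ ⟨b, hb⟩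

theorem measurable_path [Finite Q] : Measurable (path σ τ) :=
  measurable_pi_iff.2 fun k => (measurable_pi_apply (X := fun _ : Finset.Iic k => Vertex Q)
    ⟨k, Finset.mem_Iic.2 le_rfl⟩).comp (measurable_pre_path σ τ k)

/-- Given the prefix, the next vertex depends only on the bit at the current depth, which is still
unread, hence fair and independent of the prefix. -/
theorem measure_pre_path_succ [Finite Q] (k : ℕ) (ρ : FinPlay Q (k + 1)) :
    branchMeasure {b | (path σ τ b).pre (k + 1) = ρ} =
      branchMeasure {b | (path σ τ b).pre k =
          Preorder.frestrictLe₂ (π := fun _ => Vertex Q) k.le_succ ρ} *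
        stepKernel σ τ k (Preorder.frestrictLe₂ (π := fun _ => Vertex Q) k.le_succ ρ) {ρ.last} := by
  set ρ' : FinPlay Q k := Preorder.frestrictLe₂ (π := fun _ => Vertex Q) k.le_succ ρ with hρ'
  have hsplit : ∀ π : Play Q, π.pre (k + 1) = ρ ↔ π.pre k = ρ' ∧ π (k + 1) = ρ.last := by
    intro π
    constructor
    · rintro rfl
      exact ⟨rfl, rfl⟩
    · rintro ⟨h, h'⟩
      funext ⟨i, hi⟩
      rcases (Finset.mem_Iic.1 hi).lt_or_eq with hl | rfl
      · exact congrFun h ⟨i, Finset.mem_Iic.2 (by omega)⟩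
      · exact h'
  by_cases hc : ∃ c, (path σ τ c).pre k = ρ'
  · obtain ⟨c, hc⟩ := hc
    have h1 : {b | (path σ τ b).pre k = ρ'} =
        {b | ∀ i < (path σ τ c k).node.length, b i = c i} := by
      ext b
      simp only [← hc]
      exact pre_path_eq_iff c b k
    have h2 : {b | (path σ τ b).pre (k + 1) = ρ} =
        {b | (∀ i < (path σ τ c k).node.length, b i = c i) ∧ b (path σ τ c k).node.length ∈
          (fun d => (choice σ τ k ρ').succ (path σ τ c k) d) ⁻¹' {ρ.last}} := by
      ext b
      simp only [Set.mem_ofPred_eq, hsplit]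
      rw [← pre_path_eq_iff, hc]
      refine and_congr_right fun h => ?_
      rw [path_succ, h, apply_eq_of_pre_eq (h.trans hc.symm)]
      rfl
    have h3 : stepKernel σ τ k ρ' {ρ.last} = (PMF.uniformOfFintype Bool).toMeasure
        ((fun d => (choice σ τ k ρ').succ (path σ τ c k) d) ⁻¹' {ρ.last}) := by
      change ((choice σ τ k ρ').next ρ'.last).toMeasure {ρ.last} = _
      rw [Move.next_eq_map_succ, PMF.toMeasure_map_apply _ _ _ .of_discrete .of_discrete, ← hc]
      rfl
    rw [h1, h2, h3, branchMeasure_agree_inter]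
  · have h1 : {b | (path σ τ b).pre k = ρ'} = ∅ :=
      Set.eq_empty_iff_forall_notMem.2 fun b hb => hc ⟨b, hb⟩
    have h2 : {b | (path σ τ b).pre (k + 1) = ρ} = ∅ :=
      Set.eq_empty_iff_forall_notMem.2 fun b hb => hc ⟨b, ((hsplit _).1 hb).1⟩
    rw [h1, h2, measure_empty, zero_mul]

/-- The play is a deterministic function of independent fair coins indexed by the depth of nodes. -/
theorem playMeasure_eq_map [Finite Q] : playMeasure σ τ = branchMeasure.map (path σ τ) := by
  let x₀ : FinPlay Q 0 := fun _ => 𝒜.start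
  have key : ∀ k (ρ : FinPlay Q k), branchMeasure {b | (path σ τ b).pre k = ρ} =
      Kernel.partialTraj (X := fun _ => Vertex Q) (stepKernel σ τ) 0 k x₀ {ρ} := by
    intro k
    induction k with
    | zero =>
      intro ρ
      have h0 : ∀ b, (path σ τ b).pre 0 = x₀ := by
        intro b
        funext ⟨i, hi⟩
        obtain rfl : i = 0 := by simpa using hi
        rfl
      rw [Kernel.partialTraj_self, Kernel.id_apply,
        Measure.dirac_apply' _ (measurableSet_singleton ρ)]
      simp only [h0]
      by_cases h : x₀ = ρ <;> simp [h]
    | succ k ih =>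
      intro ρ
      rw [measure_pre_path_succ, ih]
      exact (partialTraj_succ_singleton (X := fun _ => Vertex Q) (stepKernel σ τ) x₀ k ρ).symm
  refine traj_eq_of_map_frestrictLe (X := fun _ => Vertex Q) (stepKernel σ τ) x₀ _ fun n => ?_
  refine Measure.ext_of_singleton fun ρ => ?_
  rw [← key, Measure.map_map (by fun_prop) (measurable_path σ τ)]
  exact Measure.map_apply (measurable_pre_path σ τ n) (measurableSet_singleton ρ)

end Path

/-! ### Countably many strategies of Adam suffice. -/

theorem exists_legal (𝒜 : Automaton A Q) (q : Q) (a : A) : ∃ m, 𝒜.Legal q a m := by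
  rcases 𝒜.complete q a with ⟨q', h⟩ | ⟨r₀, r₁, h⟩
  · exact ⟨.stay q', h⟩
  · exact ⟨.split r₀ r₁, h⟩

open Classical in
/-- The strategy of Adam which stays in the strongly connected component of the current state
whenever this is possible. -/
noncomputable def remain (𝒜 : Automaton A Q) (t : Node → A) : 𝒜.AdamStrategy t := fun _ ρ _ =>
  if h : ∃ q', 𝒜.localTr ρ.last.state (t ρ.last.node) q' ∧ 𝒜.Equivalent ρ.last.state q' then
    ⟨.stay h.choose, h.choose_spec.1⟩
  else ⟨_, (𝒜.exists_legal ρ.last.state (t ρ.last.node)).choose_spec⟩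

open Classical in
/-- The strategy of Adam which plays so as to allow the finite play `ρ`, if possible, and then
remains in strongly connected components. -/
noncomputable def followThenRemain (σ : 𝒜.EveStrategy t) {k : ℕ} (ρ : FinPlay Q k) :
    𝒜.AdamStrategy t := fun i ρ' hρ' =>
  if h : i < k ∧ ∃ τ : 𝒜.AdamStrategy t, FinConsistent σ τ ρ then h.2.choose i ρ' hρ'
  else 𝒜.remain t i ρ' hρ'

/-- At a state of Adam, the move made by `π` is local and stays in the component; limited choice
makes it the one `remain` selects. -/
theorem Consistent.choice_remain (hlimited : 𝒜.LimitedChoice) {σ : 𝒜.EveStrategy t}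
    {τ : 𝒜.AdamStrategy t} {π : Play Q} (h : Consistent σ τ π) {i : ℕ}
    (hi : 𝒜.Equivalent (π i).state (π (i + 1)).state) :
    choice σ (𝒜.remain t) i (π.pre i) = choice σ τ i (π.pre i) := by
  by_cases hE : (π.pre i).last.state ∈ 𝒜.eve
  · simp only [choice, dif_pos hE]
  · obtain ⟨d, hd⟩ := (consistent_iff.1 h).2 i
    have hl : 𝒜.Legal (π i).state (t (π i).node) _ := legal_choice σ τ i (π.pre i)
    cases hm : choice σ τ i (π.pre i) with
    | split r₀ r₁ => rw [hm] at hl; exact absurd hl ((hlimited _ hE).1 _ _ _)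
    | stay q' =>
      rw [hm] at hl hd
      have hq' : (π (i + 1)).state = q' := by rw [hd]; rfl
      rw [hq'] at hi
      have hex : ∃ q', 𝒜.localTr (π.pre i).last.state (t (π.pre i).last.node) q' ∧
          𝒜.Equivalent (π.pre i).last.state q' := ⟨q', hl, hi⟩
      simp only [choice, dif_neg hE, remain, dif_pos hex]
      rw [(hlimited _ hE).2 _ _ _ hex.choose_spec.1 hl hex.choose_spec.2 hi]

theorem Consistent.followThenRemain (hlimited : 𝒜.LimitedChoice) {σ : 𝒜.EveStrategy t}
    {τ : 𝒜.AdamStrategy t} {π : Play Q} (h : Consistent σ τ π) {k : ℕ}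
    (hk : ∀ i ≥ k, 𝒜.Equivalent (π i).state (π (i + 1)).state) :
    Consistent σ (followThenRemain σ (π.pre k)) π := by
  refine consistent_iff.2 ⟨(consistent_iff.1 h).1, fun i => ?_⟩
  have hex : ∃ τ : 𝒜.AdamStrategy t, FinConsistent σ τ (π.pre k) := ⟨τ, h k⟩
  rcases lt_or_ge i k with hik | hik
  · rw [choice_congr_adam (τ' := hex.choose)
      fun _ => by rw [Automaton.followThenRemain, dif_pos ⟨hik, hex⟩]]
    exact (finConsistent_pre_iff.1 hex.choose_spec).2 i hik
  · rw [choice_congr_adam (τ' := 𝒜.remain t)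
      fun _ => by rw [Automaton.followThenRemain, dif_neg fun hc => hc.1.not_ge hik],
      h.choice_remain hlimited (hk i hik)]
    exact (consistent_iff.1 h).2 i

/-! ### The two equivalences. -/

theorem surelyWinning_iff [Finite Q] [LinearOrder Q] (hloop : 𝒜.NoLocalLoop)
    (σ : 𝒜.EveStrategy t) :
    SurelyWinning σ ↔ ∀ q ∉ 𝒜.Fall, ¬ ∃ b, IsQBranch σ q b := by
  constructor
  · rintro h q hq ⟨b, π, hπ, -, hlim⟩
    obtain ⟨τ, hτ⟩ := hπ.exists_consistent
    obtain ⟨r, hr, hlim'⟩ := h τ π hτ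
    exact hq (hlim.unique hlim' ▸ hr)
  · intro h τ π hπ
    obtain ⟨q, hq⟩ := π.exists_isLimsup
    obtain ⟨b, hb⟩ := hπ.exists_projectsTo hloop
    by_contra hF
    exact h q (fun hqF => hF ⟨q, hqF, hq⟩) ⟨b, π, hπ.isPlayOf, hb, hq⟩

theorem almostSurelyWinning_iff_path [Finite Q] [LinearOrder Q] (σ : 𝒜.EveStrategy t) :
    AlmostSurelyWinning σ ↔
      ∀ τ : 𝒜.AdamStrategy t, ∀ᵐ b ∂branchMeasure, (path σ τ b).LimsupIn 𝒜.Fone := by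
  refine forall_congr' fun τ => ?_
  rw [playMeasure_eq_map, ae_map_iff (measurable_path σ τ).aemeasurable
    (Play.measurableSet_limsupIn _)]

theorem almostSurelyWinning_iff [Finite Q] [LinearOrder Q] (hlimited : 𝒜.LimitedChoice)
    (hloop : 𝒜.NoLocalLoop) (σ : 𝒜.EveStrategy t) :
    AlmostSurelyWinning σ ↔ ∀ q ∉ 𝒜.Fone, branchMeasure {b | IsQBranch σ q b} = 0 := by
  rw [almostSurelyWinning_iff_path]
  constructor
  · intro h q hq
    -- Finite plays are countable, so one null set serves all these strategies at once.
    have hae : ∀ᵐ b ∂branchMeasure, ∀ ρ : (k : ℕ) × FinPlay Q k,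
        (path σ (followThenRemain σ ρ.2) b).LimsupIn 𝒜.Fone :=
      ae_all_iff.2 fun ρ => h _
    have hnot : ∀ᵐ b ∂branchMeasure, ¬ IsQBranch σ q b := by
      filter_upwards [hae] with b hb
      rintro ⟨π, hπ, hproj, hlim⟩
      obtain ⟨τ, hτ⟩ := hπ.exists_consistent
      obtain ⟨k, hk⟩ := hτ.eventually_equivalent
      obtain ⟨r, hr, hlim'⟩ := hb ⟨k, π.pre k⟩
      rw [← (hτ.followThenRemain hlimited hk).eq_path hproj] at hlim'
      exact hq (hlim.unique hlim' ▸ hr)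
    simpa [ae_iff] using hnot
  · intro h τ
    have hae : ∀ᵐ b ∂branchMeasure, ∀ q, q ∉ 𝒜.Fone → ¬ IsQBranch σ q b := by
      refine ae_all_iff.2 fun q => ?_
      by_cases hq : q ∈ 𝒜.Fone
      · exact .of_forall fun b hq' => absurd hq hq'
      · filter_upwards [measure_eq_zero_iff_ae_notMem.1 (h q hq)] with b hb _ using hb
    filter_upwards [hae] with b hb
    obtain ⟨q, hq⟩ := (path σ τ b).exists_isLimsup
    by_contra hF
    exact hb q (fun hqF => hF ⟨q, hqF, hq⟩)
      ⟨_, (consistent_path σ τ b).isPlayOf, projectsTo_path σ τ b hloop, hq⟩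

end Automaton

end NonzeroAutomata

theorem mainTheorem9 {A Q : Type*} [Finite A] [Finite Q] [LinearOrder Q]
    (𝒜 : NonzeroAutomata.Automaton A Q)
    (hlimited : 𝒜.LimitedChoice) (hloop : 𝒜.NoLocalLoop)
    (t : NonzeroAutomata.Node → A)
    (σ : 𝒜.EveStrategy t) (hσ : σ.Positional) :
    (NonzeroAutomata.Automaton.SurelyWinning σ ↔
      ∀ q ∉ 𝒜.Fall, ¬ ∃ b : NonzeroAutomata.Branch,
        NonzeroAutomata.Automaton.IsQBranch σ q b) ∧
    (NonzeroAutomata.Automaton.AlmostSurelyWinning σ ↔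
      ∀ q ∉ 𝒜.Fone, NonzeroAutomata.branchMeasure
        {b | NonzeroAutomata.Automaton.IsQBranch σ q b} = 0) := by
  exact ⟨NonzeroAutomata.Automaton.surelyWinning_iff hloop σ,
    NonzeroAutomata.Automaton.almostSurelyWinning_iff hlimited hloop σ⟩
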